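/- Let $\mathbb D=\{z\in\mathbb C:|z|<1\}$, and let $dA$ be the area measure on $\mathbb D$ normalized so that $A(\mathbb D)=1$. For $1<p<\infty$, let $B^p$ be the space of functions $f$ analytic in $\mathbb D$ with $$(p-1)\int_{\mathbb D}(1-|z|^2)^{p-2}|f'(z)|^p\,dA(z)<\infty ;$$ let $B^1$ be the space of functions $f$ analytic in $\mathbb D$ with $\int_{\mathbb D}|f''(z)|\,dA(z)<\infty$; let $H^\infty$ be the space of bounded analytic functions in $\mathbb D$; and for $g$ analytic in $\mathbb D$ and $0\le r<1$ put $M_p(r,g)=\left(\frac1{2\pi}\int_0^{2\pi}|g(re^{i\theta})|^p\,d\theta\right)^{1/p}$. **Theorem.** Suppose that $1<p<\infty$ and let $\phi$ be a positive increasing (not necessarily strictly increasing) function defined on $[0,1)$ satisfying $$\int_0^1(1-r)^{p-2}\phi(r)^p\,dr<\infty .$$ Then there exists a function $f\in (B^p\cap H^\infty)\setminus B^1$ with the following two properties: (i) there is a constant $C>0$ such that $M_p(r,f')\ge C\,\phi(r)$ for all $r\in[0,1)$; (ii) $\displaystyle\int_0^1|f''(re^{i\theta})|\,dr=\infty$ for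 every $\theta\in[0,2\pi]$. -/

import Mathlib

open MeasureTheory Set Metric
open scoped ENNReal

noncomputable section

namespace DiscSpaces

/-- The open unit disc of the complex plane. -/
def disc : Set ℂ := ball 0 1

/-- The area measure on the unit disc, normalized to have total mass one. -/
def areaMeasure : Measure ℂ := (ENNReal.ofReal Real.pi)⁻¹ • volume.restrict disc

/-- The integral mean `M_p(r, g)` of order `p` (`0 < p < ∞`) over the circle `|z| = r`. -/
def integralMean (p r : ℝ) (g : ℂ → ℂ) : ℝ :=
  (Real.circleAverage (fun z => ‖g z‖ ^ p) 0 r) ^ (1 / p)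

/-- The space `H^∞` of bounded analytic functions in the unit disc. -/
def HardyInfty : Set (ℂ → ℂ) :=
  {f | DifferentiableOn ℂ f disc ∧ ∃ C : ℝ, ∀ z ∈ disc, ‖f z‖ ≤ C}

/-- The weighted Bergman norm of `f` (`0 < p < ∞`, `-1 < α`), with values in `[0, ∞]`. -/
def bergmanNorm (p α : ℝ) (f : ℂ → ℂ) : ℝ≥0∞ :=
  (ENNReal.ofReal (α + 1) *
    ∫⁻ z, ENNReal.ofReal ((1 - ‖z‖ ^ 2) ^ α) * ‖f z‖ₑ ^ p ∂areaMeasure) ^ (1 / p)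

/-- The weighted Bergman space `A^p_α` (`0 < p < ∞`, `-1 < α`). -/
def Bergman (p α : ℝ) : Set (ℂ → ℂ) :=
  {f | DifferentiableOn ℂ f disc ∧ bergmanNorm p α f < ⊤}

/-- The analytic Besov space `B^p` for `1 < p < ∞`. -/
def Besov (p : ℝ) : Set (ℂ → ℂ) :=
  {f | DifferentiableOn ℂ f disc ∧ deriv f ∈ Bergman p (p - 2)}

/-- The space `B^1`: analytic functions in the unit disc whose second derivative
is in the unweighted Bergman space `A^1`. -/
def BesovOne : Set (ℂ → ℂ) :=
  {f | DifferentiableOn ℂ f disc ∧ deriv (deriv f) ∈ Bergman 1 0}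

end DiscSpaces

end

/-! The function is the lacunary series `f(z) = ∑ (b k / L^k) z^(L^k)` with `L ≥ 4096` and `b k =
φ(1 - L^(-(k+1)))`, so that `f'` has coefficients `b k` at the exponents `L^k - 1`.

Discretizing the integral condition on `φ` gives `∑ b k ^ p L^(k(1-p)) < ∞`
(`summable_rpow_of_lintegral_lt_top`). This forces `∑ b k / L^k < ∞`, hence boundedness, and through
a weighted Hölder inequality and Gamma integrals it puts `f` in `B^p` (`series_mem_besov`).

A mean of order `p ≥ 1` dominates every Taylor coefficient (`coeff_le_integralMean`). For `1 -
L^(-k) ≤ r ≤ 1 - L^(-(k+1))` the `k`-th term alone gives `M_p(r, f') ≥ e⁻¹ b k ≥ e⁻¹ φ(r)`.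

Since `b k / L^k` tends to zero, infinitely many `k` have `b k / L^k` at least as large as all later
ratios. For these the `k`-th term controls `f''` on an annulus of width `1/(4 L^k)`
(`le_norm_deriv_deriv_series`), which contributes at least `b k / 16 ≥ b 0 / 16` on each radius. The
annuli are disjoint, so every radial integral diverges, and polar coordinates then exclude `B^1`. -/

namespace LacunarySeries

open DiscSpaces

/-- The lacunary series `∑ (b k / L ^ k) z ^ (L ^ k)`. -/
noncomputable def series (L : ℕ) (b : ℕ → ℝ) (z : ℂ) : ℂ :=
  ∑' k, ((b k / (L : ℝ) ^ k : ℝ) : ℂ) * z ^ (L ^ k)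

/-! ### Termwise differentiation of the series -/

section Analytic

variable {L : ℕ} {b : ℕ → ℝ}

lemma isOpen_disc : IsOpen disc := isOpen_ball

lemma norm_lt_one_of_mem_disc {z : ℂ} (hz : z ∈ disc) : ‖z‖ < 1 := by
  simpa [disc] using hz

lemma mem_disc_of_norm_lt_one {z : ℂ} (hz : ‖z‖ < 1) : z ∈ disc := by
  simpa [disc] using hz

lemma norm_term_le (hb : ∀ k, 0 ≤ b k) (k : ℕ) {z : ℂ} (hz : z ∈ disc) :
    ‖((b k / (L : ℝ) ^ k : ℝ) : ℂ) * z ^ (L ^ k)‖ ≤ b k / (L : ℝ) ^ k := by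
  have h0 : 0 ≤ b k / (L : ℝ) ^ k := div_nonneg (hb k) (by positivity)
  rw [norm_mul, Complex.norm_real, Real.norm_of_nonneg h0, norm_pow]
  exact mul_le_of_le_one_right h0
    (pow_le_one₀ (norm_nonneg _) (norm_lt_one_of_mem_disc hz).le)

lemma differentiableOn_series (hb : ∀ k, 0 ≤ b k)
    (hs : Summable fun k => b k / (L : ℝ) ^ k) : DifferentiableOn ℂ (series L b) disc :=
  Complex.differentiableOn_tsum_of_summable_norm hs (fun i => by fun_prop) isOpen_disc
    (fun k _ hz => norm_term_le hb k hz)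

lemma series_mem_hardyInfty (hb : ∀ k, 0 ≤ b k)
    (hs : Summable fun k => b k / (L : ℝ) ^ k) : series L b ∈ HardyInfty :=
  ⟨differentiableOn_series hb hs, _, fun _ hz =>
    tsum_of_norm_bounded hs.hasSum fun k => norm_term_le hb k hz⟩

lemma hasSum_deriv_series (hL : 2 ≤ L) (hb : ∀ k, 0 ≤ b k)
    (hs : Summable fun k => b k / (L : ℝ) ^ k) {z : ℂ} (hz : z ∈ disc) :
    HasSum (fun k => (b k : ℂ) * z ^ (L ^ k - 1)) (deriv (series L b) z) := by
  have h := Complex.hasSum_deriv_of_summable_norm hs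
    (F := fun k z => ((b k / (L : ℝ) ^ k : ℝ) : ℂ) * z ^ (L ^ k)) (fun i => by fun_prop)
    isOpen_disc (fun k _ hz => norm_term_le hb k hz) hz
  refine h.congr_fun fun k => ?_
  have hL0 : (L : ℂ) ^ k ≠ 0 := pow_ne_zero _ (by norm_cast; omega)
  rw [deriv_const_mul _ (by fun_prop)]
  simp only [deriv_pow_field]
  push_cast
  field_simp

lemma hasSum_deriv_deriv_series (hL : 2 ≤ L) (hb : ∀ k, 0 ≤ b k)
    (hs : Summable fun k => b k / (L : ℝ) ^ k) {z : ℂ} (hz : z ∈ disc) :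
    HasSum (fun k => (b k : ℂ) * (((L ^ k - 1 : ℕ) : ℂ) * z ^ (L ^ k - 1 - 1)))
      (deriv (deriv (series L b)) z) := by
  -- The coefficients `b k` need not be summable, so the Weierstrass test for `f'` is applied on a
  -- smaller disc, with majorant the terms at `ρ`.
  obtain ⟨ρ, hzρ, hρ⟩ := exists_between (norm_lt_one_of_mem_disc hz)
  have hρ0 : 0 < ρ := (norm_nonneg z).trans_lt hzρ
  have hρd : (ρ : ℂ) ∈ disc := mem_disc_of_norm_lt_one (by
    rwa [Complex.norm_real, Real.norm_of_nonneg hρ0.le])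
  have hu := (hasSum_deriv_series hL hb hs hρd).summable.norm
  have hzb : z ∈ ball (0 : ℂ) ρ := by simpa using hzρ
  have h := Complex.hasSum_deriv_of_summable_norm hu
    (F := fun k z => (b k : ℂ) * z ^ (L ^ k - 1)) (fun i => by fun_prop)
    isOpen_ball (fun k w hw => by
      have : ‖w‖ ≤ ρ := by simpa using (mem_ball_zero_iff.mp hw).le
      rw [norm_mul, norm_mul, norm_pow, norm_pow, Complex.norm_real ρ, Real.norm_of_nonneg hρ0.le]
      gcongr) hzb
  have he : deriv (series L b) =ᶠ[nhds z] fun w => ∑' k, (b k : ℂ) * w ^ (L ^ k - 1) := by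
    filter_upwards [isOpen_disc.mem_nhds hz] with w hw
    exact (hasSum_deriv_series hL hb hs hw).tsum_eq.symm
  rw [he.deriv_eq]
  refine h.congr_fun fun k => ?_
  rw [deriv_const_mul _ (by fun_prop)]
  simp only [deriv_pow_field]

/-- The factor `z ^ 2` restores the exponents `L ^ k`. At `k = 0`, where the natural subtraction `L
^ k - 1 - 1` truncates, the coefficient vanishes. -/
lemma hasSum_sq_mul_deriv_deriv_series (hL : 2 ≤ L) (hb : ∀ k, 0 ≤ b k)
    (hs : Summable fun k => b k / (L : ℝ) ^ k) {z : ℂ} (hz : z ∈ disc) :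
    HasSum (fun k => ((b k * ((L : ℝ) ^ k - 1) : ℝ) : ℂ) * z ^ (L ^ k))
      (z ^ 2 * deriv (deriv (series L b)) z) := by
  refine ((hasSum_deriv_deriv_series hL hb hs hz).mul_left (z ^ 2)).congr_fun fun k => ?_
  have h1 : 1 ≤ L ^ k := Nat.one_le_pow _ _ (by omega)
  rcases h1.eq_or_lt with h | h
  · have h' : (L : ℂ) ^ k = 1 := by exact_mod_cast h.symm
    rw [← h]
    push_cast
    rw [h']
    simp
  · have : z ^ (L ^ k) = z ^ 2 * z ^ (L ^ k - 1 - 1) := by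
      rw [← pow_add]
      congr 1
      omega
    rw [this, Nat.cast_sub h1]
    push_cast
    ring

end Analytic

/-! ### Lower bound for integral means by Taylor coefficients -/

section IntegralMean

variable {L : ℕ} {b : ℕ → ℝ}

lemma integral_exp_int_mul {l : ℤ} (hl : l ≠ 0) :
    ∫ θ in (0 : ℝ)..2 * Real.pi, Complex.exp (l * Complex.I * θ) = 0 := by
  have hc : (l : ℂ) * Complex.I ≠ 0 := by simp [hl]
  rw [integral_exp_mul_complex hc]
  have : Complex.exp ((l : ℂ) * Complex.I * ((2 * Real.pi : ℝ) : ℂ)) = 1 := by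
    rw [← Complex.exp_int_mul_two_pi_mul_I l]
    push_cast
    ring_nf
  rw [this]
  simp

lemma circleMap_mem_disc {r : ℝ} (h0 : 0 ≤ r) (h1 : r < 1) (θ : ℝ) : circleMap 0 r θ ∈ disc :=
  mem_disc_of_norm_lt_one (by rw [norm_circleMap_zero, abs_of_nonneg h0]; exact h1)

lemma continuousOn_deriv_series (hb : ∀ k, 0 ≤ b k)
    (hs : Summable fun k => b k / (L : ℝ) ^ k) : ContinuousOn (deriv (series L b)) disc :=
  ((differentiableOn_series hb hs).deriv isOpen_disc).continuousOn

lemma continuous_deriv_series_circleMap (hb : ∀ k, 0 ≤ b k)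
    (hs : Summable fun k => b k / (L : ℝ) ^ k) {r : ℝ} (h0 : 0 ≤ r) (h1 : r < 1) :
    Continuous fun θ => deriv (series L b) (circleMap 0 r θ) :=
  (continuousOn_deriv_series hb hs).comp_continuous (continuous_circleMap 0 r)
    (circleMap_mem_disc h0 h1)

/-- Orthogonality of the exponentials isolates the `k`-th coefficient; the exponents `L ^ j - 1` are
distinct, and absolute convergence on the circle justifies termwise integration. -/
lemma integral_deriv_series_mul_exp (hL : 2 ≤ L) (hb : ∀ k, 0 ≤ b k)
    (hs : Summable fun k => b k / (L : ℝ) ^ k) {r : ℝ} (h0 : 0 ≤ r) (h1 : r < 1) (k : ℕ) :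
    ∫ θ in (0 : ℝ)..2 * Real.pi, deriv (series L b) (circleMap 0 r θ) *
      Complex.exp (-((L ^ k - 1 : ℕ) : ℂ) * Complex.I * θ) =
      ((2 * Real.pi * (b k * r ^ (L ^ k - 1)) : ℝ) : ℂ) := by
  have hrd : (r : ℂ) ∈ disc := mem_disc_of_norm_lt_one (by
    rwa [Complex.norm_real, Real.norm_of_nonneg h0])
  have hsum := (hasSum_deriv_series hL hb hs hrd).summable.norm
  have hnorm : ∀ θ : ℝ, ‖Complex.exp (-((L ^ k - 1 : ℕ) : ℂ) * Complex.I * θ)‖ = 1 := by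
    intro θ
    have : -((L ^ k - 1 : ℕ) : ℂ) * Complex.I * θ =
        ((-((L ^ k - 1 : ℕ) : ℝ) * θ : ℝ) : ℂ) * Complex.I := by
      push_cast
      ring
    rw [this, Complex.norm_exp_ofReal_mul_I]
  have key := intervalIntegral.hasSum_integral_of_dominated_convergence (μ := volume)
    (a := 0) (b := 2 * Real.pi)
    (F := fun j θ => ((b j : ℂ) * circleMap 0 r θ ^ (L ^ j - 1)) *
      Complex.exp (-((L ^ k - 1 : ℕ) : ℂ) * Complex.I * θ))
    (f := fun θ => deriv (series L b) (circleMap 0 r θ) *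
      Complex.exp (-((L ^ k - 1 : ℕ) : ℂ) * Complex.I * θ))
    (fun j _ => ‖(b j : ℂ) * (r : ℂ) ^ (L ^ j - 1)‖)
    (fun j => by
      refine Continuous.aestronglyMeasurable ?_
      have := continuous_circleMap 0 r
      fun_prop)
    (fun j => Filter.Eventually.of_forall fun θ _ => by
      rw [norm_mul, hnorm, mul_one, norm_mul, norm_mul, norm_pow, norm_pow, norm_circleMap_zero,
        Complex.norm_real r, Real.norm_eq_abs])
    (Filter.Eventually.of_forall fun _ _ => hsum)
    (by simp)
    (Filter.Eventually.of_forall fun θ _ =>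
      (hasSum_deriv_series hL hb hs (circleMap_mem_disc h0 h1 θ)).mul_right _)
  refine key.unique ?_
  have hterm : ∀ j (θ : ℝ), ((b j : ℂ) * circleMap 0 r θ ^ (L ^ j - 1)) *
      Complex.exp (-((L ^ k - 1 : ℕ) : ℂ) * Complex.I * θ) =
      ((b j * r ^ (L ^ j - 1) : ℝ) : ℂ) *
        Complex.exp ((((L ^ j - 1 : ℕ) : ℤ) - ((L ^ k - 1 : ℕ) : ℤ) : ℤ) * Complex.I * θ) := by
    intro j θ
    rw [circleMap_zero, mul_pow, ← Complex.exp_nat_mul]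
    have hexp : Complex.exp ((((L ^ j - 1 : ℕ) : ℤ) - ((L ^ k - 1 : ℕ) : ℤ) : ℤ) * Complex.I * θ) =
        Complex.exp ((L ^ j - 1 : ℕ) * (θ * Complex.I)) *
          Complex.exp (-((L ^ k - 1 : ℕ) : ℂ) * Complex.I * θ) := by
      rw [← Complex.exp_add]
      congr 1
      push_cast
      ring
    rw [hexp, Complex.ofReal_mul, Complex.ofReal_pow]
    ring
  simp_rw [hterm, intervalIntegral.integral_const_mul]
  have hval := hasSum_single (f := fun j => ((b j * r ^ (L ^ j - 1) : ℝ) : ℂ) *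
      ∫ θ in (0 : ℝ)..2 * Real.pi,
        Complex.exp ((((L ^ j - 1 : ℕ) : ℤ) - ((L ^ k - 1 : ℕ) : ℤ) : ℤ) * Complex.I * θ)) k
    (fun j hj => by
      rw [integral_exp_int_mul, mul_zero]
      have hne : L ^ j ≠ L ^ k := fun h => hj (Nat.pow_right_injective hL h)
      have := Nat.one_le_pow j L (by omega)
      have := Nat.one_le_pow k L (by omega)
      omega)
  rw [show ((2 * Real.pi * (b k * r ^ (L ^ k - 1)) : ℝ) : ℂ) =
    ((b k * r ^ (L ^ k - 1) : ℝ) : ℂ) *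
      ∫ θ in (0 : ℝ)..2 * Real.pi, Complex.exp (((0 : ℤ) : ℂ) * Complex.I * θ) by
    simp
    ring]
  simpa only [sub_self] using hval

/-- The integral mean dominates each Taylor coefficient. -/
lemma coeff_le_integralMean {p : ℝ} (hp : 1 ≤ p) (hL : 2 ≤ L) (hb : ∀ k, 0 ≤ b k)
    (hs : Summable fun k => b k / (L : ℝ) ^ k) {r : ℝ} (h0 : 0 ≤ r) (h1 : r < 1) (k : ℕ)
    (hA : 0 < b k * r ^ (L ^ k - 1)) :
    b k * r ^ (L ^ k - 1) ≤ integralMean p r (deriv (series L b)) := by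
  set A := b k * r ^ (L ^ k - 1) with hAdef
  have hp0 : 0 < p := by linarith
  have hpi := Real.pi_pos
  set g : ℝ → ℂ := fun θ => deriv (series L b) (circleMap 0 r θ) with hg
  have hgc : Continuous g := continuous_deriv_series_circleMap hb hs h0 h1
  set e : ℝ → ℂ := fun θ => Complex.exp (-((L ^ k - 1 : ℕ) : ℂ) * Complex.I * θ) with he
  have hec : Continuous e := by fun_prop
  have hen : ∀ θ, ‖e θ‖ = 1 := by
    intro θ
    have : -((L ^ k - 1 : ℕ) : ℂ) * Complex.I * θ =
        ((-((L ^ k - 1 : ℕ) : ℝ) * θ : ℝ) : ℂ) * Complex.I := by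
      push_cast
      ring
    rw [he]
    simp only
    rw [this, Complex.norm_exp_ofReal_mul_I]
  have hint : ∫ θ in (0 : ℝ)..2 * Real.pi, (g θ * e θ).re = 2 * Real.pi * A := by
    have h := integral_deriv_series_mul_exp hL hb hs h0 h1 k
    have h2 := Complex.reCLM.intervalIntegral_comp_comm (μ := volume) (a := 0) (b := 2 * Real.pi)
      ((hgc.mul hec).intervalIntegrable 0 (2 * Real.pi))
    simp only [Complex.reCLM_apply, Pi.mul_apply] at h2
    rw [h2]
    change (∫ θ in (0 : ℝ)..2 * Real.pi, g θ * e θ).re = _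
    rw [show (∫ θ in (0 : ℝ)..2 * Real.pi, g θ * e θ) = ((2 * Real.pi * A : ℝ) : ℂ) from h,
      Complex.ofReal_re]
  -- The convex function `x ^ p` lies above its tangent at `A` (Bernoulli). The linear term averages
  -- to zero by `hint`, so integrating gives a form of Jensen's inequality.
  have hpt : ∀ θ, A ^ p + p * A ^ (p - 1) * ((g θ * e θ).re - A) ≤ ‖g θ‖ ^ p := by
    intro θ
    have hre : (g θ * e θ).re ≤ ‖g θ‖ := by
      refine (Complex.re_le_norm _).trans ?_
      rw [norm_mul, hen, mul_one]
    have hB := one_add_mul_self_le_rpow_one_add (s := ‖g θ‖ / A - 1)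
      (by have : 0 ≤ ‖g θ‖ / A := by positivity
          linarith) hp
    rw [add_sub_cancel, Real.div_rpow (norm_nonneg _) hA.le] at hB
    have hAp : 0 < A ^ p := Real.rpow_pos_of_pos hA p
    rw [le_div_iff₀ hAp] at hB
    refine le_trans ?_ hB
    rw [Real.rpow_sub_one hA.ne']
    calc A ^ p + p * (A ^ p / A) * ((g θ * e θ).re - A)
        ≤ A ^ p + p * (A ^ p / A) * (‖g θ‖ - A) := by gcongr
      _ = (1 + p * (‖g θ‖ / A - 1)) * A ^ p := by field_simp
  have hmono : A ^ p ≤ Real.circleAverage (fun z => ‖deriv (series L b) z‖ ^ p) 0 r := by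
    rw [Real.circleAverage_def, smul_eq_mul]
    have hle := intervalIntegral.integral_mono (μ := volume) (a := 0) (b := 2 * Real.pi)
      (by positivity)
      (f := fun θ => A ^ p + p * A ^ (p - 1) * ((g θ * e θ).re - A)) (g := fun θ => ‖g θ‖ ^ p)
      (Continuous.intervalIntegrable (by fun_prop) _ _)
      (Continuous.intervalIntegrable
        (hgc.norm.rpow_const fun _ => Or.inr hp0.le) _ _) hpt
    have hre : IntervalIntegrable (fun θ => (g θ * e θ).re) volume 0 (2 * Real.pi) :=
      Continuous.intervalIntegrable (by fun_prop) _ _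
    rw [intervalIntegral.integral_add (by simp) ((hre.sub (by simp)).const_mul _),
      intervalIntegral.integral_const_mul, intervalIntegral.integral_sub hre (by simp), hint]
      at hle
    simp only [intervalIntegral.integral_const, smul_eq_mul, sub_zero, sub_self, mul_zero,
      add_zero] at hle
    rw [inv_mul_eq_div, le_div_iff₀ (by positivity)]
    linarith
  calc A = (A ^ p) ^ (1 / p) := by
        rw [← Real.rpow_mul hA.le, mul_one_div_cancel hp0.ne', Real.rpow_one]
    _ ≤ _ := by
        unfold integralMean
        gcongr

end IntegralMean

/-! ### Divergence of the radial integrals of the second derivative -/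

section RadialVariation

variable {L : ℕ} {b : ℕ → ℝ}

/-- Here `r ^ N ≤ e^(-m/4)`, and `(m/4)^3 / 3! ≤ e^(m/4)`, with `384 = 3! * 4 ^ 3`. The cube pays
for two factors `m` of growth in the tail terms and leaves one for geometric decay. -/
lemma mul_pow_le_of_le_one_sub {n m r : ℝ} (hn : 0 < n) (hm : 1 ≤ m) {N : ℕ} (hN : (N : ℝ) = n * m)
    (h0 : 0 ≤ r) (hr : r ≤ 1 - 1 / (4 * n)) : m ^ 3 * r ^ N ≤ 384 := by
  have h1 : r ≤ Real.exp (-(1 / (4 * n))) := by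
    have := Real.add_one_le_exp (-(1 / (4 * n)))
    linarith
  have h2 : r ^ N ≤ Real.exp (-(m / 4)) := by
    calc r ^ N ≤ Real.exp (-(1 / (4 * n))) ^ N := by gcongr
      _ = Real.exp (-(m / 4)) := by
        rw [← Real.exp_nat_mul, hN]
        congr 1
        field_simp
  have h3 := Real.pow_div_factorial_le_exp (m / 4) (by positivity) 3
  have h4 : Real.exp (m / 4) * Real.exp (-(m / 4)) = 1 := by
    rw [← Real.exp_add, add_neg_cancel, Real.exp_zero]
  have h5 : m ^ 3 ≤ 384 * Real.exp (m / 4) := by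
    norm_num [Nat.factorial] at h3
    nlinarith
  calc m ^ 3 * r ^ N ≤ 384 * Real.exp (m / 4) * Real.exp (-(m / 4)) := by gcongr
    _ = 384 := by rw [mul_assoc, h4, mul_one]

/-- If the normalized coefficients beyond the `k`-th are at most the `k`-th one, then the `k`-th
term dominates the second derivative on an annulus of width comparable to `L ^ (-k)`. -/
lemma le_norm_deriv_deriv_series (hL : 4096 ≤ L) (hb : ∀ k, 0 ≤ b k) (hbm : Monotone b)
    (hs : Summable fun k => b k / (L : ℝ) ^ k) {k : ℕ} (hk : 1 ≤ k)
    (hgood : ∀ j, k ≤ j → b j / (L : ℝ) ^ j ≤ b k / (L : ℝ) ^ k) {z : ℂ}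
    (h1 : 1 - 1 / (2 * (L : ℝ) ^ k) ≤ ‖z‖) (h2 : ‖z‖ ≤ 1 - 1 / (4 * (L : ℝ) ^ k)) :
    b k * (L : ℝ) ^ k / 4 ≤ ‖deriv (deriv (series L b)) z‖ := by
  have hLR : (4096 : ℝ) ≤ L := by exact_mod_cast hL
  have hL0 : (0 : ℝ) < L := by linarith
  set n : ℝ := (L : ℝ) ^ k with hn
  have hn1 : (4096 : ℝ) ≤ n := hLR.trans (le_self_pow₀ (by linarith) (by omega))
  have hn0 : 0 < n := by linarith
  have hz1 : ‖z‖ < 1 := by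
    have : 0 < 1 / (4 * n) := by positivity
    linarith
  have hzd := mem_disc_of_norm_lt_one hz1
  set T : ℕ → ℂ := fun j => ((b j * ((L : ℝ) ^ j - 1) : ℝ) : ℂ) * z ^ (L ^ j) with hT
  have hTs : HasSum T _ := hasSum_sq_mul_deriv_deriv_series (by omega) hb hs hzd
  have hpow1 : ∀ j, (1 : ℝ) ≤ (L : ℝ) ^ j := fun j => one_le_pow₀ (by linarith)
  have hTn : ∀ j, ‖T j‖ = b j * ((L : ℝ) ^ j - 1) * ‖z‖ ^ (L ^ j) := by
    intro j
    rw [hT]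
    simp only
    rw [norm_mul, norm_pow, Complex.norm_real,
      Real.norm_of_nonneg (mul_nonneg (hb j) (by linarith [hpow1 j]))]
  have hlow : ‖∑ j ∈ Finset.range k, T j‖ ≤ b k * n / 4095 := by
    have hg := geom_sum_mul (L : ℝ) k
    calc ‖∑ j ∈ Finset.range k, T j‖ ≤ ∑ j ∈ Finset.range k, ‖T j‖ := norm_sum_le _ _
      _ ≤ ∑ j ∈ Finset.range k, b k * (L : ℝ) ^ j := by
        refine Finset.sum_le_sum fun j hj => ?_
        rw [hTn]
        have hjk : b j ≤ b k := hbm (Finset.mem_range.mp hj).le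
        have h3 : (L : ℝ) ^ j - 1 ≤ (L : ℝ) ^ j := by linarith
        have h4 : ‖z‖ ^ (L ^ j) ≤ 1 := pow_le_one₀ (norm_nonneg _) hz1.le
        calc b j * ((L : ℝ) ^ j - 1) * ‖z‖ ^ (L ^ j) ≤ b j * ((L : ℝ) ^ j - 1) * 1 :=
              mul_le_mul_of_nonneg_left h4 (mul_nonneg (hb j) (by linarith [hpow1 j]))
          _ ≤ b k * (L : ℝ) ^ j := by
              rw [mul_one]
              exact mul_le_mul hjk h3 (by linarith [hpow1 j]) (hb k)
      _ = b k * ∑ j ∈ Finset.range k, (L : ℝ) ^ j := by rw [Finset.mul_sum]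
      _ ≤ b k * (n / 4095) := by
        refine mul_le_mul_of_nonneg_left ?_ (hb k)
        rw [le_div_iff₀ (by norm_num)]
        have hS : 0 ≤ ∑ j ∈ Finset.range k, (L : ℝ) ^ j := by positivity
        nlinarith
      _ = b k * n / 4095 := by ring
  -- With `m = L ^ (i + 1)`, `hgood` gives `b (i+k+1) ≤ b k * m` and the exponent is `n * m`; the
  -- cubic decay leaves `384 * b k * n / m`. The geometric sum is at most `2 * 384 / 4096 = 3 / 16`
  -- times `b k * n`.
  have hhigh : ‖∑' i, T (i + (k + 1))‖ ≤ b k * n * (3 / 16) := by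
    have hq : (1 : ℝ) / L ≤ 1 / 4096 := one_div_le_one_div_of_le (by norm_num) hLR
    have hg := (hasSum_geometric_of_lt_one (r := 1 / (L : ℝ)) (by positivity)
      (by linarith)).mul_right (384 * b k * n * (1 / L))
    refine (tsum_of_norm_bounded hg fun i => ?_).trans ?_
    · rw [hTn]
      set m : ℝ := (L : ℝ) ^ (i + 1) with hm
      have hm1 : 1 ≤ m := hpow1 _
      have hnm : (L : ℝ) ^ (i + (k + 1)) = n * m := by rw [hn, hm]; ring
      have h3 := mul_pow_le_of_le_one_sub (r := ‖z‖) hn0 hm1 (N := L ^ (i + (k + 1)))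
        (by push_cast; exact hnm) (norm_nonneg _) h2
      have h4 : b (i + (k + 1)) ≤ b k * m := by
        have := hgood (i + (k + 1)) (by omega)
        rw [hnm, div_le_iff₀ (by positivity)] at this
        calc _ ≤ _ := this
          _ = b k * m := by field_simp
      have hx : 0 ≤ ‖z‖ ^ (L ^ (i + (k + 1))) := by positivity
      rw [hnm]
      have h5 : (1 / (L : ℝ)) ^ i * (384 * b k * n * (1 / L)) = b k * n * 384 / m := by
        rw [hm, one_div_pow]
        field_simp
        ring
      rw [h5, le_div_iff₀ (by positivity)]
      calc b (i + (k + 1)) * (n * m - 1) * ‖z‖ ^ (L ^ (i + (k + 1))) * m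
          ≤ (b k * m) * (n * m) * ‖z‖ ^ (L ^ (i + (k + 1))) * m := by
            gcongr
            · nlinarith
            · exact mul_nonneg (hb k) (by linarith)
            · linarith
        _ = b k * n * (m ^ 3 * ‖z‖ ^ (L ^ (i + (k + 1)))) := by ring
        _ ≤ b k * n * 384 :=
            mul_le_mul_of_nonneg_left h3 (mul_nonneg (hb k) hn0.le)
    · have h6 : (1 - 1 / (L : ℝ))⁻¹ ≤ 2 := by
        rw [inv_le_comm₀ (by linarith) (by norm_num)]
        linarith
      have hbn : 0 ≤ b k * n := mul_nonneg (hb k) hn0.le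
      calc (1 - 1 / (L : ℝ))⁻¹ * (384 * b k * n * (1 / L))
          ≤ 2 * (384 * b k * n * (1 / 4096)) := by
            have := hb k
            gcongr
        _ = b k * n * (3 / 16) := by ring
  -- Bernoulli gives `‖z‖ ^ n ≥ 1/2`, and `n - 1 ≥ (4095/4096) n`. Since `4095/8192 - 1/4095 - 3/16
  -- > 1/4`, this term beats both the head and the tail.
  have hmain : b k * n * (4095 / 8192) ≤ ‖T k‖ := by
    rw [hTn, ← hn]
    have hber := one_add_mul_le_pow (a := -(1 / (2 * n))) (by
      have : 1 / (2 * n) ≤ 1 := by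
        rw [div_le_one (by positivity)]
        linarith
      linarith) (L ^ k)
    have h3 : (1 : ℝ) / 2 ≤ ‖z‖ ^ (L ^ k) := by
      calc (1 : ℝ) / 2 = 1 + ((L ^ k : ℕ) : ℝ) * -(1 / (2 * n)) := by
            push_cast
            rw [← hn]
            field_simp
            norm_num
        _ ≤ (1 + -(1 / (2 * n))) ^ (L ^ k) := hber
        _ ≤ ‖z‖ ^ (L ^ k) := by
            have : 1 / (2 * n) ≤ 1 := by
              rw [div_le_one (by positivity)]
              linarith
            exact pow_le_pow_left₀ (by linarith) (by linarith) _
    calc b k * n * (4095 / 8192) = b k * (n * (4095 / 4096)) * (1 / 2) := by ring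
      _ ≤ b k * (n - 1) * ‖z‖ ^ (L ^ k) := by
        have := hb k
        gcongr
        · exact mul_nonneg this (by linarith)
        · linarith
  have hsplit : z ^ 2 * deriv (deriv (series L b)) z =
      ∑ j ∈ Finset.range k, T j + T k + ∑' i, T (i + (k + 1)) := by
    rw [← hTs.tsum_eq, ← hTs.summable.sum_add_tsum_nat_add (k + 1), Finset.sum_range_succ]
  have htri : ‖T k‖ ≤ ‖z ^ 2 * deriv (deriv (series L b)) z‖ + ‖∑ j ∈ Finset.range k, T j‖ +
      ‖∑' i, T (i + (k + 1))‖ := by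
    have : T k = z ^ 2 * deriv (deriv (series L b)) z - ∑ j ∈ Finset.range k, T j -
      ∑' i, T (i + (k + 1)) := by rw [hsplit]; ring
    rw [this]
    exact (norm_sub_le _ _).trans (by gcongr; exact norm_sub_le _ _)
  have hle : ‖z ^ 2 * deriv (deriv (series L b)) z‖ ≤ ‖deriv (deriv (series L b)) z‖ := by
    rw [norm_mul, norm_pow]
    exact mul_le_of_le_one_left (norm_nonneg _) (pow_le_one₀ (norm_nonneg _) hz1.le)
  have hbn : 0 ≤ b k * n := mul_nonneg (hb k) hn0.le
  linarith

/-- A positive sequence tending to zero has infinitely many indices at which it dominates all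
its later terms. -/
lemma infinite_setOf_forall_ge_le {a : ℕ → ℝ} (ha : ∀ k, 0 < a k)
    (h : Filter.Tendsto a Filter.atTop (nhds 0)) :
    {k | 1 ≤ k ∧ ∀ j, k ≤ j → a j ≤ a k}.Infinite := by
  refine Set.infinite_of_forall_exists_gt fun m => ?_
  obtain ⟨M, hM⟩ := Filter.eventually_atTop.mp (h.eventually (gt_mem_nhds (ha (m + 1))))
  -- From `M` on the terms are below `a (m + 1)`, so a maximum over this finite window dominates
  -- everything later.
  obtain ⟨k, hk, hmax⟩ := Finset.exists_max_image (Finset.Icc (m + 1) (max M (m + 1))) a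
    ⟨m + 1, by simp⟩
  rw [Finset.mem_Icc] at hk
  refine ⟨k, ⟨by omega, fun j hj => ?_⟩, by omega⟩
  by_cases hjM : j ≤ max M (m + 1)
  · exact hmax j (Finset.mem_Icc.mpr ⟨by omega, hjM⟩)
  · have h1 : a j < a (m + 1) := hM j (by have := le_max_left M (m + 1); omega)
    exact h1.le.trans (hmax (m + 1) (by simp))

lemma lintegral_norm_deriv_deriv_series_eq_top (hL : 4096 ≤ L) (hb : ∀ k, 0 < b k)
    (hbm : Monotone b) (hs : Summable fun k => b k / (L : ℝ) ^ k) (θ : ℝ) :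
    ∫⁻ r in Ico (1 / 2 : ℝ) 1,
      ‖deriv (deriv (series L b)) ((r : ℂ) * Complex.exp ((θ : ℂ) * Complex.I))‖ₑ = ⊤ := by
  have hLR : (4096 : ℝ) ≤ L := by exact_mod_cast hL
  have hL0 : (0 : ℝ) < L := by linarith
  set S := {k | 1 ≤ k ∧ ∀ j, k ≤ j → b j / (L : ℝ) ^ j ≤ b k / (L : ℝ) ^ k} with hS
  have hSinf : S.Infinite := infinite_setOf_forall_ge_le
    (fun k => div_pos (hb k) (by positivity)) hs.tendsto_atTop_zero
  have : Infinite S := hSinf.to_subtype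
  set J : ℕ → Set ℝ := fun k => Ico (1 - 1 / (2 * (L : ℝ) ^ k)) (1 - 1 / (4 * (L : ℝ) ^ k)) with hJ
  have hpow1 : ∀ j, (1 : ℝ) ≤ (L : ℝ) ^ j := fun j => one_le_pow₀ (by linarith)
  have hdisj : Pairwise fun i j : S => Disjoint (J i) (J j) := by
    have key : ∀ i j : ℕ, i < j → Disjoint (J i) (J j) := by
      intro i j hij
      refine Set.disjoint_left.mpr fun x hx hx' => ?_
      have h1 : (L : ℝ) ^ i * 4096 ≤ (L : ℝ) ^ j :=
        calc (L : ℝ) ^ i * 4096 ≤ (L : ℝ) ^ i * L := by gcongr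
          _ = (L : ℝ) ^ (i + 1) := by ring
          _ ≤ (L : ℝ) ^ j := pow_le_pow_right₀ (by linarith) hij
      have h2 : 1 / (2 * (L : ℝ) ^ j) ≤ 1 / (4 * (L : ℝ) ^ i) :=
        one_div_le_one_div_of_le (by positivity) (by linarith [hpow1 i])
      linarith [hx.2, hx'.1]
    intro i j hij
    rcases lt_or_gt_of_ne (fun h => hij (Subtype.ext h) : (i : ℕ) ≠ j) with h | h
    · exact key _ _ h
    · exact (key _ _ h).symm
  set g : ℝ → ℝ≥0∞ := fun r =>
    ‖deriv (deriv (series L b)) ((r : ℂ) * Complex.exp ((θ : ℂ) * Complex.I))‖ₑ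
  have hone : ∀ k : S, ENNReal.ofReal (b 0 / 16) ≤ ∫⁻ r in J k, g r := by
    rintro ⟨k, hk1, hk⟩
    have hn0 : (0 : ℝ) < (L : ℝ) ^ k := by positivity
    have hlb : ∀ r ∈ J k, ENNReal.ofReal (b k * (L : ℝ) ^ k / 4) ≤ g r := by
      intro r hr
      have hr0 : 0 ≤ r := by
        have : 1 / (2 * (L : ℝ) ^ k) ≤ 1 := by
          rw [div_le_one (by positivity)]
          linarith [hpow1 k]
        linarith [hr.1]
      have hnr : ‖(r : ℂ) * Complex.exp ((θ : ℂ) * Complex.I)‖ = r := by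
        rw [norm_mul, Complex.norm_exp_ofReal_mul_I, mul_one, Complex.norm_real,
          Real.norm_of_nonneg hr0]
      change _ ≤ ‖deriv (deriv (series L b)) _‖ₑ
      rw [← ofReal_norm]
      refine ENNReal.ofReal_le_ofReal (le_norm_deriv_deriv_series hL (fun k => (hb k).le) hbm hs
        hk1 hk ?_ ?_)
      · rw [hnr]; exact hr.1
      · rw [hnr]; exact hr.2.le
    -- Height `b k * L ^ k / 4` times width `1 / (4 * L ^ k)` is `b k / 16`, whatever the scale.
    calc ENNReal.ofReal (b 0 / 16) ≤ ENNReal.ofReal (b k / 16) := by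
          gcongr
          exact hbm (Nat.zero_le k)
      _ = ENNReal.ofReal (b k * (L : ℝ) ^ k / 4) * volume (J k) := by
          rw [hJ]
          simp only
          rw [Real.volume_Ico, ← ENNReal.ofReal_mul
            (by have := (hb k).le; positivity)]
          congr 1
          field_simp
          ring
      _ = ∫⁻ _ in J k, ENNReal.ofReal (b k * (L : ℝ) ^ k / 4) := (setLIntegral_const _ _).symm
      _ ≤ ∫⁻ r in J k, g r := setLIntegral_mono' measurableSet_Ico hlb
  have hsub : (⋃ k : S, J k) ⊆ Ico (1 / 2 : ℝ) 1 := by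
    refine Set.iUnion_subset fun k x hx => ⟨?_, ?_⟩
    · have : 1 / (2 * (L : ℝ) ^ (k : ℕ)) ≤ 1 / 2 :=
        one_div_le_one_div_of_le (by norm_num) (by linarith [hpow1 k])
      linarith [hx.1]
    · have : 0 < 1 / (4 * (L : ℝ) ^ (k : ℕ)) := by positivity
      linarith [hx.2]
  refine top_le_iff.mp ?_
  calc (⊤ : ℝ≥0∞) = ∑' _ : S, ENNReal.ofReal (b 0 / 16) :=
        (ENNReal.tsum_const_eq_top_of_ne_zero (by simpa using hb 0)).symm
    _ ≤ ∑' k : S, ∫⁻ r in J k, g r := ENNReal.tsum_le_tsum hone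
    _ = ∫⁻ r in ⋃ k : S, J k, g r :=
        (lintegral_iUnion (fun _ => measurableSet_Ico) hdisj _).symm
    _ ≤ ∫⁻ r in Ico (1 / 2 : ℝ) 1, g r := lintegral_mono_set hsub

end RadialVariation

/-! ### Polar coordinates on the disc and a Gamma integral -/

section PolarCoordinates

lemma lintegral_disc_eq_polar {F : ℂ → ℝ≥0∞} (hF : Measurable F) :
    ∫⁻ z in disc, F z = ∫⁻ θ in Ioo (-Real.pi) Real.pi, ∫⁻ r in Ioo (0 : ℝ) 1,
      ENNReal.ofReal r * F ((r : ℂ) * Complex.exp ((θ : ℂ) * Complex.I)) := by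
  have hind : Measurable (disc.indicator F) := hF.indicator isOpen_disc.measurableSet
  rw [← lintegral_indicator isOpen_disc.measurableSet, ← Complex.lintegral_comp_polarCoord_symm,
    polarCoord_target, Measure.volume_eq_prod, ← Measure.prod_restrict, lintegral_prod_symm]
  · refine lintegral_congr fun θ => ?_
    have hcongr : ∀ r ∈ Ioi (0 : ℝ), ENNReal.ofReal (r, θ).1 •
        disc.indicator F (Complex.polarCoord.symm (r, θ)) =
        (Iio (1 : ℝ)).indicator (fun r =>
          ENNReal.ofReal r * F ((r : ℂ) * Complex.exp ((θ : ℂ) * Complex.I))) r := by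
      intro r hr
      have hz : Complex.polarCoord.symm (r, θ) = (r : ℂ) * Complex.exp ((θ : ℂ) * Complex.I) := by
        rw [Complex.polarCoord_symm_apply, Complex.exp_mul_I]
        push_cast
        rfl
      have hn : ‖(r : ℂ) * Complex.exp ((θ : ℂ) * Complex.I)‖ = r := by
        rw [norm_mul, Complex.norm_exp_ofReal_mul_I, mul_one, Complex.norm_real,
          Real.norm_of_nonneg (le_of_lt hr)]
      rw [hz, smul_eq_mul]
      by_cases h1 : r < 1
      · rw [indicator_of_mem (mem_disc_of_norm_lt_one (by rwa [hn])),
          indicator_of_mem (show r ∈ Iio (1 : ℝ) from h1)]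
      · rw [indicator_of_notMem, indicator_of_notMem (show r ∉ Iio (1 : ℝ) from h1), mul_zero]
        intro h
        have := norm_lt_one_of_mem_disc h
        rw [hn] at this
        exact h1 this
    rw [setLIntegral_congr_fun measurableSet_Ioi hcongr, setLIntegral_indicator measurableSet_Iio]
    congr 2
    ext x
    simp [and_comm]
  · refine Measurable.aemeasurable ?_
    refine (ENNReal.measurable_ofReal.comp measurable_fst).mul (hind.comp ?_)
    have : (Complex.polarCoord.symm : ℝ × ℝ → ℂ) = fun p : ℝ × ℝ =>
        (p.1 : ℂ) * ((Real.cos p.2 : ℂ) + (Real.sin p.2 : ℂ) * Complex.I) :=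
      funext Complex.polarCoord_symm_apply
    rw [this]
    fun_prop

lemma lintegral_disc_radial {G : ℝ → ℝ≥0∞} (hG : Measurable G) :
    ∫⁻ z in disc, G ‖z‖ = ENNReal.ofReal (2 * Real.pi) *
      ∫⁻ r in Ioo (0 : ℝ) 1, ENNReal.ofReal r * G r := by
  rw [lintegral_disc_eq_polar (F := fun z => G ‖z‖) (hG.comp measurable_norm)]
  have : ∀ θ : ℝ, ∫⁻ r in Ioo (0 : ℝ) 1,
      ENNReal.ofReal r * G ‖(r : ℂ) * Complex.exp ((θ : ℂ) * Complex.I)‖ =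
      ∫⁻ r in Ioo (0 : ℝ) 1, ENNReal.ofReal r * G r := by
    intro θ
    refine setLIntegral_congr_fun measurableSet_Ioo fun r hr => ?_
    rw [norm_mul, Complex.norm_exp_ofReal_mul_I, mul_one, Complex.norm_real,
      Real.norm_of_nonneg hr.1.le]
  simp_rw [this]
  rw [setLIntegral_const, Real.volume_Ioo, mul_comm]
  congr 2
  ring

lemma lintegral_rpow_mul_exp_Ioi {a n : ℝ} (ha : 0 < a) (hn : 0 < n) :
    ∫⁻ t in Ioi (0 : ℝ), ENNReal.ofReal (t ^ (a - 1) * Real.exp (-(n * t))) =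
      ENNReal.ofReal ((1 / n) ^ a * Real.Gamma a) := by
  have hval := Real.integral_rpow_mul_exp_neg_mul_Ioi ha hn
  rw [← hval, ofReal_integral_eq_lintegral_ofReal]
  · refine Integrable.of_integral_ne_zero ?_
    rw [hval]
    have := Real.Gamma_pos_of_pos ha
    positivity
  · refine (ae_restrict_mem measurableSet_Ioi).mono fun t ht => ?_
    have : 0 < t := ht
    simp only [Pi.zero_apply]
    positivity

lemma lintegral_Ioo_one_sub_le (h : ℝ → ℝ≥0∞) :
    ∫⁻ r in Ioo (0 : ℝ) 1, h (1 - r) ≤ ∫⁻ t in Ioi (0 : ℝ), h t := by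
  rw [← lintegral_indicator measurableSet_Ioo, ← lintegral_indicator measurableSet_Ioi,
    ← lintegral_sub_left_eq_self ((Ioi (0 : ℝ)).indicator h) 1]
  refine lintegral_mono fun r => ?_
  by_cases hr : r ∈ Ioo (0 : ℝ) 1
  · rw [indicator_of_mem hr, indicator_of_mem (show 1 - r ∈ Ioi (0 : ℝ) from sub_pos.mpr hr.2)]
  · rw [indicator_of_notMem hr]
    exact zero_le

end PolarCoordinates

/-! ### Membership in the Besov space -/

section BesovNorm

variable {L : ℕ} {b : ℕ → ℝ}

/-- With `q = √L` and `τ = √t`, each term is at most an increment of `4 q^k / (1 + q^k τ)`, a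
sequence bounded by `4 / τ`, and the increments telescope. The termwise bound uses `e^(-x²) ≤
1/(1+x²)` and `q ≥ 2`. -/
lemma sum_sqrt_pow_mul_exp_le (hL : 4 ≤ L) {t : ℝ} (ht : 0 < t) (K : ℕ) :
    ∑ k ∈ Finset.range K, √((L : ℝ) ^ k) * Real.exp (-((L : ℝ) ^ k * t)) ≤ 4 / √t := by
  set q := √(L : ℝ) with hq
  set τ := √t with hτ
  have hτ0 : 0 < τ := Real.sqrt_pos.mpr ht
  have hτ2 : τ ^ 2 = t := Real.sq_sqrt ht.le
  have hq2 : 2 ≤ q := Real.le_sqrt_of_sq_le (by norm_num; exact_mod_cast hL)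
  have hqq : q ^ 2 = L := Real.sq_sqrt (by positivity)
  have hs : ∀ k : ℕ, √((L : ℝ) ^ k) = q ^ k := by
    intro k
    rw [← hqq, ← pow_mul, mul_comm, pow_mul, Real.sqrt_sq (by positivity)]
  set G : ℕ → ℝ := fun k => 4 * q ^ k / (1 + q ^ k * τ) with hG
  have hstep : ∀ k, √((L : ℝ) ^ k) * Real.exp (-((L : ℝ) ^ k * t)) ≤ G (k + 1) - G k := by
    intro k
    have hs0 : 0 < q ^ k := by positivity
    set s := q ^ k with hsdef
    have hx : (L : ℝ) ^ k * t = (s * τ) ^ 2 := by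
      rw [mul_pow, hτ2, hsdef, ← pow_mul, mul_comm k, pow_mul, hqq]
    have hexp : Real.exp (-((s * τ) ^ 2)) ≤ 1 / (1 + (s * τ) ^ 2) := by
      rw [Real.exp_neg, ← one_div]
      refine one_div_le_one_div_of_le (by positivity) ?_
      linarith [Real.add_one_le_exp ((s * τ) ^ 2)]
    have hdiff : G (k + 1) - G k = s * (4 * (q - 1) / ((1 + q * (s * τ)) * (1 + s * τ))) := by
      simp only [hG, pow_succ, ← hsdef]
      have h1 : 1 + s * q * τ ≠ 0 := by positivity
      have h2 : 1 + s * τ ≠ 0 := by positivity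
      have h3 : 1 + q * (s * τ) ≠ 0 := by positivity
      field_simp
      ring
    rw [hs, hx, hdiff]
    refine mul_le_mul_of_nonneg_left (hexp.trans ?_) hs0.le
    have hx0 : 0 < s * τ := by positivity
    set x := s * τ
    rw [div_le_div_iff₀ (by positivity) (by positivity), one_mul]
    nlinarith [mul_nonneg (by linarith : 0 ≤ q) (sq_nonneg (x - 1)),
      mul_nonneg (by linarith : 0 ≤ q - 2) (sq_nonneg x), mul_nonneg (by linarith : 0 ≤ q - 1) hx0.le]
  calc ∑ k ∈ Finset.range K, √((L : ℝ) ^ k) * Real.exp (-((L : ℝ) ^ k * t))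
      ≤ ∑ k ∈ Finset.range K, (G (k + 1) - G k) := Finset.sum_le_sum fun k _ => hstep k
    _ = G K - G 0 := Finset.sum_range_sub G K
    _ ≤ G K := by
        have : 0 ≤ G 0 := by simp only [hG]; positivity
        linarith
    _ ≤ 4 / τ := by
        simp only [hG]
        rw [div_le_div_iff₀ (by positivity) hτ0]
        nlinarith [pow_pos (by linarith : 0 < q) K]

lemma pow_sub_one_le_exp {r : ℝ} (h0 : 0 ≤ r) {N : ℕ} (hN : 1 ≤ N) :
    r ^ (N - 1) ≤ Real.exp 1 * Real.exp (-(N * (1 - r))) := by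
  have h2 : r ≤ Real.exp (-(1 - r)) := by
    have := Real.add_one_le_exp (-(1 - r))
    linarith
  calc r ^ (N - 1) ≤ Real.exp (-(1 - r)) ^ (N - 1) := by gcongr
    _ = Real.exp (((N - 1 : ℕ) : ℝ) * -(1 - r)) := by rw [← Real.exp_nat_mul]
    _ ≤ Real.exp (1 + -(N * (1 - r))) := by
        rw [Nat.cast_sub hN]
        gcongr
        push_cast
        nlinarith
    _ = _ := Real.exp_add _ _

/-- Hölder's inequality with weights `s k * E k`, where `s k = √(L^k)`, applied to `b k / s k`. The
square root splits the power of `L^k` evenly, so the total weight costs only `(1 - ‖z‖)^(-1/2)` and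
the remaining singularity stays integrable. -/
lemma norm_partialSum_rpow_le {p : ℝ} (hp : 1 < p) (hL : 4 ≤ L) (hb : ∀ k, 0 ≤ b k) {z : ℂ}
    (hz : z ∈ disc) (K : ℕ) :
    ‖∑ k ∈ Finset.range K, (b k : ℂ) * z ^ (L ^ k - 1)‖ ^ p ≤
      Real.exp 1 ^ p * 4 ^ (p - 1) * (1 - ‖z‖) ^ (-((p - 1) / 2)) *
        ∑ k ∈ Finset.range K, b k ^ p * √((L : ℝ) ^ k) ^ (1 - p) *
          Real.exp (-((L : ℝ) ^ k * (1 - ‖z‖))) := by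
  have hp0 : 0 < p := by linarith
  have hL0 : (0 : ℝ) < L := by exact_mod_cast (by omega : 0 < L)
  have hz1 := norm_lt_one_of_mem_disc hz
  set t := 1 - ‖z‖ with ht
  have ht0 : 0 < t := by linarith
  set s : ℕ → ℝ := fun k => √((L : ℝ) ^ k) with hs
  have hs0 : ∀ k, 0 < s k := fun k => Real.sqrt_pos.mpr (by positivity)
  set E : ℕ → ℝ := fun k => Real.exp (-((L : ℝ) ^ k * t)) with hE
  have hE0 : ∀ k, 0 < E k := fun k => Real.exp_pos _
  have h1 : ‖∑ k ∈ Finset.range K, (b k : ℂ) * z ^ (L ^ k - 1)‖ ≤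
      Real.exp 1 * ∑ k ∈ Finset.range K, (s k * E k) * (b k / s k) := by
    rw [Finset.mul_sum]
    refine (norm_sum_le _ _).trans (Finset.sum_le_sum fun k _ => ?_)
    rw [norm_mul, norm_pow, Complex.norm_real, Real.norm_of_nonneg (hb k)]
    have h2 := pow_sub_one_le_exp (norm_nonneg z) (Nat.one_le_pow k L (by omega))
    push_cast at h2
    calc b k * ‖z‖ ^ (L ^ k - 1) ≤ b k * (Real.exp 1 * E k) :=
          mul_le_mul_of_nonneg_left h2 (hb k)
      _ = Real.exp 1 * ((s k * E k) * (b k / s k)) := by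
          have := (hs0 k).ne'
          field_simp
  have hw0 : ∀ k, 0 ≤ s k * E k := fun k => (mul_pos (hs0 k) (hE0 k)).le
  have hf0 : ∀ k, 0 ≤ b k / s k := fun k => div_nonneg (hb k) (hs0 k).le
  have hH := Real.inner_le_weight_mul_Lp_of_nonneg (Finset.range K) hp.le (fun k => s k * E k)
    (fun k => b k / s k) hw0 hf0
  set A := ∑ k ∈ Finset.range K, s k * E k with hA
  set B := ∑ k ∈ Finset.range K, (s k * E k) * (b k / s k) ^ p with hB
  have hA0 : 0 ≤ A := Finset.sum_nonneg fun k _ => hw0 k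
  have hB0 : 0 ≤ B := Finset.sum_nonneg fun k _ => mul_nonneg (hw0 k)
    (Real.rpow_nonneg (hf0 k) _)
  have hAle : A ≤ 4 / √t := sum_sqrt_pow_mul_exp_le hL ht0 K
  have hBeq : B = ∑ k ∈ Finset.range K, b k ^ p * s k ^ (1 - p) * E k := by
    refine Finset.sum_congr rfl fun k _ => ?_
    rw [Real.div_rpow (hb k) (hs0 k).le, Real.rpow_sub (hs0 k), Real.rpow_one]
    ring
  have hsum0 : 0 ≤ ∑ k ∈ Finset.range K, (s k * E k) * (b k / s k) :=
    Finset.sum_nonneg fun k _ => mul_nonneg (hw0 k) (hf0 k)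
  have hS : (∑ k ∈ Finset.range K, (s k * E k) * (b k / s k)) ^ p ≤ A ^ (p - 1) * B := by
    calc _ ≤ (A ^ (1 - p⁻¹) * B ^ p⁻¹) ^ p := Real.rpow_le_rpow hsum0 hH hp0.le
      _ = A ^ (p - 1) * B := by
        rw [Real.mul_rpow (Real.rpow_nonneg hA0 _) (Real.rpow_nonneg hB0 _), ← Real.rpow_mul hA0,
          ← Real.rpow_mul hB0, inv_mul_cancel₀ hp0.ne', Real.rpow_one]
        congr 2
        field_simp
  have hApow : A ^ (p - 1) ≤ 4 ^ (p - 1) * t ^ (-((p - 1) / 2)) := by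
    calc A ^ (p - 1) ≤ (4 / √t) ^ (p - 1) := Real.rpow_le_rpow hA0 hAle (by linarith)
      _ = 4 ^ (p - 1) * t ^ (-((p - 1) / 2)) := by
        rw [Real.div_rpow (by norm_num) (Real.sqrt_nonneg _), Real.sqrt_eq_rpow,
          ← Real.rpow_mul ht0.le, div_eq_mul_inv, ← Real.rpow_neg ht0.le]
        congr 2
        ring
  calc _ ≤ (Real.exp 1 * ∑ k ∈ Finset.range K, (s k * E k) * (b k / s k)) ^ p :=
        Real.rpow_le_rpow (norm_nonneg _) h1 hp0.le
    _ = Real.exp 1 ^ p * (∑ k ∈ Finset.range K, (s k * E k) * (b k / s k)) ^ p :=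
        Real.mul_rpow (Real.exp_pos 1).le hsum0
    _ ≤ Real.exp 1 ^ p * ((4 ^ (p - 1) * t ^ (-((p - 1) / 2))) * B) := by
        gcongr
        exact hS.trans (by gcongr)
    _ = _ := by rw [hBeq]; ring

lemma enorm_deriv_series_rpow_le {p : ℝ} (hp : 1 < p) (hL : 4 ≤ L) (hb : ∀ k, 0 ≤ b k)
    (hs : Summable fun k => b k / (L : ℝ) ^ k) {z : ℂ} (hz : z ∈ disc) :
    ‖deriv (series L b) z‖ₑ ^ p ≤
      ENNReal.ofReal (Real.exp 1 ^ p * 4 ^ (p - 1) * (1 - ‖z‖) ^ (-((p - 1) / 2))) *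
        ∑' k, ENNReal.ofReal (b k ^ p * √((L : ℝ) ^ k) ^ (1 - p) *
          Real.exp (-((L : ℝ) ^ k * (1 - ‖z‖)))) := by
  have ht := ((ENNReal.continuous_rpow_const (y := p)).tendsto _).comp
    (hasSum_deriv_series (by omega) hb hs hz).tendsto_sum_nat.enorm
  refine le_of_tendsto' ht fun K => ?_
  have hz1 := norm_lt_one_of_mem_disc hz
  have hC : 0 ≤ Real.exp 1 ^ p * 4 ^ (p - 1) * (1 - ‖z‖) ^ (-((p - 1) / 2)) := by
    have : 0 < 1 - ‖z‖ := by linarith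
    positivity
  have hnn : ∀ k, 0 ≤ b k ^ p * √((L : ℝ) ^ k) ^ (1 - p) *
      Real.exp (-((L : ℝ) ^ k * (1 - ‖z‖))) := fun k => by
    have := hb k
    positivity
  simp only [Function.comp_apply]
  rw [← ofReal_norm, ENNReal.ofReal_rpow_of_nonneg (norm_nonneg _) (by linarith)]
  refine (ENNReal.ofReal_le_ofReal (norm_partialSum_rpow_le hp hL hb hz K)).trans ?_
  rw [ENNReal.ofReal_mul hC, ENNReal.ofReal_sum_of_nonneg fun k _ => hnn k]
  gcongr
  exact ENNReal.sum_le_tsum _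

/-- The exponent `p - 2` may be negative; since `1 ≤ 1 + r ≤ 2`, raising it to `p` covers both
signs. -/
lemma one_sub_sq_rpow_le {r p : ℝ} (h0 : 0 < r) (h1 : r < 1) (hp : 1 < p) :
    (1 - r ^ 2) ^ (p - 2) ≤ 2 ^ p * (1 - r) ^ (p - 2) := by
  have h2 : 1 - r ^ 2 = (1 + r) * (1 - r) := by ring
  rw [h2, Real.mul_rpow (by linarith) (by linarith)]
  have h3 : (1 + r) ^ (p - 2) ≤ 2 ^ p :=
    calc (1 + r) ^ (p - 2) ≤ (1 + r) ^ p :=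
          Real.rpow_le_rpow_of_exponent_le (by linarith) (by linarith)
      _ ≤ 2 ^ p := Real.rpow_le_rpow (by linarith) (by linarith) (by linarith)
  exact mul_le_mul_of_nonneg_right h3 (Real.rpow_nonneg (by linarith) _)

lemma series_mem_besov {p : ℝ} (hp : 1 < p) (hL : 4 ≤ L) (hb : ∀ k, 0 ≤ b k)
    (hs : Summable fun k => b k / (L : ℝ) ^ k)
    (hsp : Summable fun k => b k ^ p * ((L : ℝ) ^ k) ^ (1 - p)) : series L b ∈ Besov p := by
  have hp0 : 0 < p := by linarith
  have hL0 : (0 : ℝ) < L := by exact_mod_cast (by omega : 0 < L)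
  have hd := differentiableOn_series hb hs
  refine ⟨hd, hd.deriv isOpen_disc, ?_⟩
  set C₀ := Real.exp 1 ^ p * 4 ^ (p - 1) with hC₀
  have hC₀0 : 0 < C₀ := by positivity
  set σ := (p - 1) / 2 with hσ
  have hσ0 : 0 < σ := by rw [hσ]; linarith
  set d : ℕ → ℝ := fun k => b k ^ p * √((L : ℝ) ^ k) ^ (1 - p) with hd'
  have hd0 : ∀ k, 0 ≤ d k := fun k => by
    have := hb k
    positivity
  set G : ℝ → ℝ≥0∞ := fun r => ENNReal.ofReal ((1 - r ^ 2) ^ (p - 2)) *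
    (ENNReal.ofReal (C₀ * (1 - r) ^ (-σ)) *
      ∑' k, ENNReal.ofReal (d k * Real.exp (-((L : ℝ) ^ k * (1 - r))))) with hG
  have hGm : Measurable G := by fun_prop
  -- The powers of `1 - r` combine to `(p - 2) - σ = σ - 1`, integrable against the exponential. The
  -- Gamma integral yields `L^(-kσ)`, which with `√(L^k)^(1-p)` makes exactly `L^(k(1-p))`.
  have hradial : ∫⁻ r in Ioo (0 : ℝ) 1, ENNReal.ofReal r * G r < ⊤ := by
    calc ∫⁻ r in Ioo (0 : ℝ) 1, ENNReal.ofReal r * G r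
        ≤ ∫⁻ r in Ioo (0 : ℝ) 1, ∑' k, ENNReal.ofReal (2 ^ p * C₀ * d k) *
            ENNReal.ofReal ((1 - r) ^ (σ - 1) * Real.exp (-((L : ℝ) ^ k * (1 - r)))) := by
          refine setLIntegral_mono' measurableSet_Ioo fun r hr => ?_
          have ht : 0 < 1 - r := by linarith [hr.2]
          have hr1 : ENNReal.ofReal r ≤ 1 := by
            rw [← ENNReal.ofReal_one]
            exact ENNReal.ofReal_le_ofReal hr.2.le
          refine (mul_le_of_le_one_left zero_le hr1).trans ?_
          simp only [hG]
          rw [← ENNReal.tsum_mul_left, ← ENNReal.tsum_mul_left]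
          refine ENNReal.tsum_le_tsum fun k => ?_
          have hbase : 0 ≤ 1 - r ^ 2 := by nlinarith [hr.1, hr.2]
          rw [← ENNReal.ofReal_mul (by positivity), ← ENNReal.ofReal_mul (by positivity),
            ← ENNReal.ofReal_mul (by have := hd0 k; positivity)]
          refine ENNReal.ofReal_le_ofReal ?_
          have hsplit : (1 - r) ^ (σ - 1) = (1 - r) ^ (p - 2) * (1 - r) ^ (-σ) := by
            rw [← Real.rpow_add ht]
            congr 1
            rw [hσ]
            ring
          rw [hsplit]
          have hdk := hd0 k
          calc (1 - r ^ 2) ^ (p - 2) * (C₀ * (1 - r) ^ (-σ) *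
                (d k * Real.exp (-((L : ℝ) ^ k * (1 - r)))))
              ≤ (2 ^ p * (1 - r) ^ (p - 2)) * (C₀ * (1 - r) ^ (-σ) *
                (d k * Real.exp (-((L : ℝ) ^ k * (1 - r))))) :=
                mul_le_mul_of_nonneg_right (one_sub_sq_rpow_le hr.1 hr.2 hp) (by positivity)
            _ = _ := by ring
      _ = ∑' k, ENNReal.ofReal (2 ^ p * C₀ * d k) * ∫⁻ r in Ioo (0 : ℝ) 1,
            ENNReal.ofReal ((1 - r) ^ (σ - 1) * Real.exp (-((L : ℝ) ^ k * (1 - r)))) := by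
          rw [lintegral_tsum fun k => by fun_prop]
          refine tsum_congr fun k => ?_
          rw [lintegral_const_mul _ (by fun_prop)]
      _ ≤ ∑' k, ENNReal.ofReal (2 ^ p * C₀ * d k) *
            ENNReal.ofReal ((1 / (L : ℝ) ^ k) ^ σ * Real.Gamma σ) := by
          refine ENNReal.tsum_le_tsum fun k => ?_
          gcongr
          rw [← lintegral_rpow_mul_exp_Ioi hσ0 (by positivity)]
          exact lintegral_Ioo_one_sub_le
            (fun t => ENNReal.ofReal (t ^ (σ - 1) * Real.exp (-((L : ℝ) ^ k * t))))
      _ = ∑' k, ENNReal.ofReal (2 ^ p * C₀ * Real.Gamma σ *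
            (b k ^ p * ((L : ℝ) ^ k) ^ (1 - p))) := by
          refine tsum_congr fun k => ?_
          rw [← ENNReal.ofReal_mul (by have := hd0 k; positivity)]
          congr 1
          have hN : (0 : ℝ) < (L : ℝ) ^ k := by positivity
          simp only [hd']
          rw [Real.sqrt_eq_rpow, ← Real.rpow_mul hN.le, one_div ((L : ℝ) ^ k), Real.inv_rpow hN.le,
            ← Real.rpow_neg hN.le]
          have : ((L : ℝ) ^ k) ^ (1 - p) =
              ((L : ℝ) ^ k) ^ (1 / 2 * (1 - p)) * ((L : ℝ) ^ k) ^ (-σ) := by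
            rw [← Real.rpow_add hN]
            congr 1
            rw [hσ]
            ring
          rw [this]
          ring
      _ < ⊤ := (hsp.mul_left _).tsum_ofReal_lt_top
  have hmain : ∫⁻ z, ENNReal.ofReal ((1 - ‖z‖ ^ 2) ^ (p - 2)) * ‖deriv (series L b) z‖ₑ ^ p
      ∂areaMeasure < ⊤ := by
    rw [areaMeasure, lintegral_smul_measure]
    refine ENNReal.mul_lt_top (ENNReal.inv_lt_top.mpr (by simpa using Real.pi_pos)) ?_
    calc ∫⁻ z in disc, ENNReal.ofReal ((1 - ‖z‖ ^ 2) ^ (p - 2)) * ‖deriv (series L b) z‖ₑ ^ p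
        ≤ ∫⁻ z in disc, G ‖z‖ := by
          refine setLIntegral_mono' isOpen_disc.measurableSet fun z hz => ?_
          simp only [hG]
          gcongr
          exact enorm_deriv_series_rpow_le hp hL hb hs hz
      _ = _ := lintegral_disc_radial hGm
      _ < ⊤ := ENNReal.mul_lt_top ENNReal.ofReal_lt_top hradial
  exact ENNReal.rpow_lt_top_of_nonneg (by positivity)
    (ENNReal.mul_lt_top ENNReal.ofReal_lt_top hmain).ne

end BesovNorm

/-! ### Exclusion from `B^1` -/

section Unbounded

variable {L : ℕ} {b : ℕ → ℝ}

lemma series_notMem_besovOne (hL : 4096 ≤ L) (hb : ∀ k, 0 < b k)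
    (hbm : Monotone b) (hs : Summable fun k => b k / (L : ℝ) ^ k) : series L b ∉ BesovOne := by
  rintro ⟨-, -, h⟩
  set F : ℂ → ℝ≥0∞ := fun z => ‖deriv (deriv (series L b)) z‖ₑ with hF
  have hFm : Measurable F := (measurable_deriv _).enorm
  have htop : ∫⁻ z in disc, F z = ⊤ := by
    rw [lintegral_disc_eq_polar hFm]
    have hθ : ∀ θ : ℝ, ∫⁻ r in Ioo (0 : ℝ) 1,
        ENNReal.ofReal r * F ((r : ℂ) * Complex.exp ((θ : ℂ) * Complex.I)) = ⊤ := by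
      intro θ
      refine top_le_iff.mp ?_
      -- The divergence already occurs on `r ≥ 1/2`, where the Jacobian factor `r` is bounded below.
      calc (⊤ : ℝ≥0∞) = ENNReal.ofReal (1 / 2) * ∫⁻ r in Ico (1 / 2 : ℝ) 1,
            F ((r : ℂ) * Complex.exp ((θ : ℂ) * Complex.I)) := by
            rw [hF, lintegral_norm_deriv_deriv_series_eq_top hL hb hbm hs θ, ENNReal.mul_top]
            simp
        _ = ∫⁻ r in Ico (1 / 2 : ℝ) 1, ENNReal.ofReal (1 / 2) *
            F ((r : ℂ) * Complex.exp ((θ : ℂ) * Complex.I)) :=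
            (lintegral_const_mul _ (hFm.comp (by fun_prop))).symm
        _ ≤ ∫⁻ r in Ico (1 / 2 : ℝ) 1, ENNReal.ofReal r *
            F ((r : ℂ) * Complex.exp ((θ : ℂ) * Complex.I)) := by
            refine setLIntegral_mono' measurableSet_Ico fun r hr => ?_
            gcongr
            exact hr.1
        _ ≤ _ := lintegral_mono_set (show Ico (1 / 2 : ℝ) 1 ⊆ Ioo 0 1 from
            fun r hr => ⟨by linarith [hr.1], hr.2⟩)
    simp_rw [hθ]
    rw [setLIntegral_const, Real.volume_Ioo, ENNReal.top_mul]
    simp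
    linarith [Real.pi_pos]
  have harea : ∫⁻ z, F z ∂areaMeasure = ⊤ := by
    rw [areaMeasure, lintegral_smul_measure, htop, smul_eq_mul, ENNReal.mul_top]
    simp
  rw [bergmanNorm] at h
  simp only [Real.rpow_zero, ENNReal.ofReal_one, one_mul, ENNReal.rpow_one, zero_add, div_one] at h
  rw [← hF, harea] at h
  exact lt_irrefl _ h

end Unbounded

/-! ### Discretization of the majorant `φ` -/

section Majorant

/-- Each term of a convergent nonnegative series is at most its sum `M`, so `(b k / L^k)^p ≤ M
L^(-k)`, and the `p`-th root is geometric. -/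
lemma summable_div_pow_of_summable {p : ℝ} (hp : 1 < p) {L : ℕ} (hL : 2 ≤ L) {b : ℕ → ℝ}
    (hb : ∀ k, 0 ≤ b k) (hs : Summable fun k => b k ^ p * ((L : ℝ) ^ k) ^ (1 - p)) :
    Summable fun k => b k / (L : ℝ) ^ k := by
  have hp0 : 0 < p := by linarith
  have hL1 : (1 : ℝ) < L := by exact_mod_cast (by omega : 1 < L)
  set M := ∑' k, b k ^ p * ((L : ℝ) ^ k) ^ (1 - p) with hM
  have hnn : ∀ k, 0 ≤ b k ^ p * ((L : ℝ) ^ k) ^ (1 - p) := fun k => by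
    have := hb k
    positivity
  have hM0 : 0 ≤ M := tsum_nonneg hnn
  have hle : ∀ k, b k / (L : ℝ) ^ k ≤ M ^ p⁻¹ * ((L : ℝ) ^ (-p⁻¹)) ^ k := by
    intro k
    have hN : (0 : ℝ) < (L : ℝ) ^ k := by positivity
    have h1 : (b k / (L : ℝ) ^ k) ^ p ≤ M * ((L : ℝ) ^ k)⁻¹ := by
      have h2 := hs.le_tsum k fun j _ => hnn j
      rw [Real.rpow_sub hN, Real.rpow_one, ← hM] at h2
      rw [Real.div_rpow (hb k) hN.le]
      calc b k ^ p / ((L : ℝ) ^ k) ^ p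
          = b k ^ p * ((L : ℝ) ^ k / ((L : ℝ) ^ k) ^ p) * ((L : ℝ) ^ k)⁻¹ := by field_simp
        _ ≤ M * ((L : ℝ) ^ k)⁻¹ := by gcongr
    have h3 : 0 ≤ b k / (L : ℝ) ^ k := div_nonneg (hb k) hN.le
    calc b k / (L : ℝ) ^ k = ((b k / (L : ℝ) ^ k) ^ p) ^ p⁻¹ := (Real.rpow_rpow_inv h3 hp0.ne').symm
      _ ≤ (M * ((L : ℝ) ^ k)⁻¹) ^ p⁻¹ := by gcongr
      _ = M ^ p⁻¹ * ((L : ℝ) ^ (-p⁻¹)) ^ k := by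
        rw [Real.mul_rpow hM0 (by positivity), Real.inv_rpow hN.le, ← Real.rpow_neg hN.le,
          ← Real.rpow_natCast, ← Real.rpow_natCast, ← Real.rpow_mul (by linarith),
          ← Real.rpow_mul (by linarith), mul_comm (k : ℝ)]
  refine Summable.of_nonneg_of_le (fun k => div_nonneg (hb k) (by positivity)) hle
    ((summable_geometric_of_lt_one (by positivity) ?_).mul_left _)
  exact Real.rpow_lt_one_of_one_lt_of_neg hL1 (by simpa using hp0)

variable {p : ℝ} {φ : ℝ → ℝ}

lemma one_sub_inv_pow_mem_Ico {L : ℕ} (hL : 2 ≤ L) (k : ℕ) :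
    1 - 1 / (L : ℝ) ^ k ∈ Ico (0 : ℝ) 1 := by
  have hL0 : (1 : ℝ) ≤ L := by exact_mod_cast (by omega : 1 ≤ L)
  have h1 : (1 : ℝ) ≤ (L : ℝ) ^ k := one_le_pow₀ hL0
  have h2 : 1 / (L : ℝ) ^ k ≤ 1 := by
    rw [div_le_one (by positivity)]
    exact h1
  have h3 : 0 < 1 / (L : ℝ) ^ k := by positivity
  exact ⟨by linarith, by linarith⟩

lemma strictMono_one_sub_inv_pow {L : ℕ} (hL : 2 ≤ L) :
    StrictMono fun k : ℕ => 1 - 1 / (L : ℝ) ^ k := by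
  have hL1 : (1 : ℝ) < L := by exact_mod_cast (by omega : 1 < L)
  refine strictMono_nat_of_lt_succ fun k => ?_
  have : 1 / (L : ℝ) ^ (k + 1) < 1 / (L : ℝ) ^ k :=
    one_div_lt_one_div_of_lt (by positivity) (pow_lt_pow_right₀ hL1 (Nat.lt_succ_self k))
  linarith

/-- The integral condition on a monotone function, discretized along a geometric sequence. -/
lemma summable_rpow_of_lintegral_lt_top (hp : 1 < p)
    (hpos : ∀ r ∈ Ico (0 : ℝ) 1, 0 < φ r) (hmono : MonotoneOn φ (Ico (0 : ℝ) 1))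
    (hint : ∫⁻ r in Ico (0 : ℝ) 1, ENNReal.ofReal ((1 - r) ^ (p - 2) * φ r ^ p) < ⊤)
    {L : ℕ} (hL : 2 ≤ L) :
    Summable fun k : ℕ => φ (1 - 1 / (L : ℝ) ^ (k + 1)) ^ p * ((L : ℝ) ^ k) ^ (1 - p) := by
  have hL2 : (2 : ℝ) ≤ L := by exact_mod_cast hL
  have hL0 : (0 : ℝ) < L := by linarith
  set x : ℕ → ℝ := fun k => 1 - 1 / (L : ℝ) ^ k with hx
  have hxm : ∀ k, x k ∈ Ico (0 : ℝ) 1 := one_sub_inv_pow_mem_Ico hL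
  have hxs : StrictMono x := strictMono_one_sub_inv_pow hL
  -- `J k` starts at the point where `φ` is sampled, so monotonicity makes the sample a lower bound
  -- for `φ` on `J k`.
  set J : ℕ → Set ℝ := fun k => Ico (x (k + 1)) (x (k + 2)) with hJ
  have hJsub : ∀ k, J k ⊆ Ico (0 : ℝ) 1 := fun k r hr =>
    ⟨(hxm (k + 1)).1.trans hr.1, hr.2.trans (hxm (k + 2)).2⟩
  have hdisj : Pairwise fun i j => Disjoint (J i) (J j) := by
    have key : ∀ i j : ℕ, i < j → Disjoint (J i) (J j) := fun i j hij =>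
      Set.disjoint_left.mpr fun r hr hr' =>
        absurd (hr.2.trans_le ((hxs.monotone (by omega : i + 2 ≤ j + 1)).trans hr'.1))
          (lt_irrefl r)
    intro i j hij
    rcases lt_or_gt_of_ne hij with h | h
    · exact key _ _ h
    · exact (key _ _ h).symm
  -- The factor `(L^2)^(1-p)` compares scale `k + 2` with scale `k`; the `1/2` comes from `1 - 1/L ≥
  -- 1/2` in the length of `J k`.
  set c : ℝ := ((L : ℝ) ^ 2) ^ (1 - p) / 2 with hc
  have hc0 : 0 < c := by positivity
  set a : ℕ → ℝ := fun k => φ (x (k + 1)) ^ p * ((L : ℝ) ^ k) ^ (1 - p) with ha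
  have hφ0 : ∀ k, 0 < φ (x k) := fun k => hpos _ (hxm k)
  have ha0 : ∀ k, 0 ≤ a k * c := fun k => by
    have := hφ0 (k + 1)
    positivity
  have hone : ∀ k, ENNReal.ofReal (a k * c) ≤
      ∫⁻ r in J k, ENNReal.ofReal ((1 - r) ^ (p - 2) * φ r ^ p) := by
    intro k
    have hφk := hφ0 (k + 1)
    set v : ℝ := ((L : ℝ) ^ (k + 2)) ^ (1 - p) * (L : ℝ) ^ (k + 1) with hv
    have hv0 : 0 < v := by positivity
    have hpt : ∀ r ∈ J k, ENNReal.ofReal (v * φ (x (k + 1)) ^ p) ≤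
        ENNReal.ofReal ((1 - r) ^ (p - 2) * φ r ^ p) := by
      intro r hr
      have h1 : 1 - r ≤ 1 / (L : ℝ) ^ (k + 1) := by
        have := hr.1
        simp only [hx] at this
        linarith
      have h2 : 1 / (L : ℝ) ^ (k + 2) ≤ 1 - r := by
        have := hr.2
        simp only [hx] at this
        linarith
      have ht : 0 < 1 - r := lt_of_lt_of_le (by positivity) h2
      have hvle : v ≤ (1 - r) ^ (p - 2) := by
        -- As `p - 2` has no fixed sign, the power is split into an increasing and a decreasing
        -- factor of `1 - r`, each bounded at its own endpoint of `J k`.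
        have h3 : (1 - r) ^ (p - 2) = (1 - r) ^ (p - 1) * (1 - r)⁻¹ := by
          rw [← Real.rpow_neg_one (1 - r), ← Real.rpow_add ht]
          congr 1
          ring
        rw [h3, hv]
        refine mul_le_mul ?_ ?_ (by positivity) (by positivity)
        · calc ((L : ℝ) ^ (k + 2)) ^ (1 - p) = (1 / (L : ℝ) ^ (k + 2)) ^ (p - 1) := by
                rw [one_div, Real.inv_rpow (by positivity), ← Real.rpow_neg (by positivity)]
                congr 1
                ring
            _ ≤ (1 - r) ^ (p - 1) := Real.rpow_le_rpow (by positivity) h2 (by linarith)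
        · rw [le_inv_comm₀ (by positivity) ht, ← one_div]
          exact h1
      refine ENNReal.ofReal_le_ofReal ?_
      have hφle : φ (x (k + 1)) ≤ φ r := hmono (hxm _) (hJsub k hr) hr.1
      gcongr
    have hvol : a k * c ≤ v * φ (x (k + 1)) ^ p * (x (k + 2) - x (k + 1)) := by
      have hlen : 1 / (2 * (L : ℝ) ^ (k + 1)) ≤ x (k + 2) - x (k + 1) := by
        have h4 : 1 / (L : ℝ) ^ (k + 2) ≤ 1 / (2 * (L : ℝ) ^ (k + 1)) := by
          refine one_div_le_one_div_of_le (by positivity) ?_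
          rw [pow_succ (L : ℝ) (k + 1), mul_comm]
          gcongr
        have h5 : 1 / (L : ℝ) ^ (k + 1) = 2 * (1 / (2 * (L : ℝ) ^ (k + 1))) := by field_simp
        simp only [hx]
        linarith
      calc a k * c = v * φ (x (k + 1)) ^ p * (1 / (2 * (L : ℝ) ^ (k + 1))) := by
            simp only [ha, hc, hv]
            rw [pow_add (L : ℝ) k 2, Real.mul_rpow (by positivity) (by positivity)]
            field_simp
        _ ≤ _ := by gcongr
    calc ENNReal.ofReal (a k * c)
        ≤ ENNReal.ofReal (v * φ (x (k + 1)) ^ p * (x (k + 2) - x (k + 1))) :=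
          ENNReal.ofReal_le_ofReal hvol
      _ = ENNReal.ofReal (v * φ (x (k + 1)) ^ p) * volume (J k) := by
          rw [ENNReal.ofReal_mul (by positivity), Real.volume_Ico]
      _ = ∫⁻ _ in J k, ENNReal.ofReal (v * φ (x (k + 1)) ^ p) := (setLIntegral_const _ _).symm
      _ ≤ _ := setLIntegral_mono' measurableSet_Ico hpt
  have hfin : ∑' k, ENNReal.ofReal (a k * c) ≠ ⊤ := by
    refine (lt_of_le_of_lt ?_ hint).ne
    calc ∑' k, ENNReal.ofReal (a k * c)
        ≤ ∑' k, ∫⁻ r in J k, ENNReal.ofReal ((1 - r) ^ (p - 2) * φ r ^ p) :=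
          ENNReal.tsum_le_tsum hone
      _ = ∫⁻ r in ⋃ k, J k, ENNReal.ofReal ((1 - r) ^ (p - 2) * φ r ^ p) :=
          (lintegral_iUnion (fun _ => measurableSet_Ico) hdisj _).symm
      _ ≤ _ := lintegral_mono_set (Set.iUnion_subset hJsub)
  have hsum := ENNReal.summable_toReal hfin
  simp only [ENNReal.toReal_ofReal (ha0 _)] at hsum
  exact (summable_mul_right_iff hc0.ne').mp hsum

/-- With `M = N - 1`, `1 - 1/N = (1 + 1/M)⁻¹ ≥ e^(-1/M)`, and the `M`-th power is `e⁻¹`. -/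
lemma exp_neg_one_le_pow_sub_one {N : ℕ} (hN : 1 ≤ N) {r : ℝ} (hr : 1 - 1 / (N : ℝ) ≤ r) :
    Real.exp (-1) ≤ r ^ (N - 1) := by
  rcases hN.eq_or_lt with rfl | h
  · simp
  · have hM : (0 : ℝ) < ((N - 1 : ℕ) : ℝ) := by exact_mod_cast (by omega : 0 < N - 1)
    have hNM : (N : ℝ) = ((N - 1 : ℕ) : ℝ) + 1 := by
      exact_mod_cast (by omega : N = (N - 1) + 1)
    set M : ℝ := ((N - 1 : ℕ) : ℝ) with hMdef
    have h1 : Real.exp (-(1 / M)) ≤ r := by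
      refine le_trans ?_ hr
      rw [hNM, Real.exp_neg, show 1 - 1 / (M + 1) = (1 / M + 1)⁻¹ by field_simp; ring]
      exact inv_anti₀ (by positivity) (Real.add_one_le_exp _)
    calc Real.exp (-1) = Real.exp (-(1 / M)) ^ (N - 1) := by
          rw [← Real.exp_nat_mul, ← hMdef]
          congr 1
          field_simp
      _ ≤ r ^ (N - 1) := by gcongr

lemma exists_one_sub_inv_pow_le {L : ℕ} (hL : 2 ≤ L) {r : ℝ} (hr : r ∈ Ico (0 : ℝ) 1) :
    ∃ k : ℕ, 1 - 1 / (L : ℝ) ^ k ≤ r ∧ r ≤ 1 - 1 / (L : ℝ) ^ (k + 1) := by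
  have hL1 : (1 : ℝ) < L := by exact_mod_cast (by omega : 1 < L)
  have ht : 0 < 1 - r := by linarith [hr.2]
  obtain ⟨k, hk1, hk2⟩ := exists_nat_pow_near (x := 1 / (1 - r))
    (by rw [le_div_iff₀ ht]; linarith [hr.1]) hL1
  refine ⟨k, ?_, ?_⟩
  · have := (le_one_div (by positivity) ht).mp hk1
    linarith
  · have := (one_div_lt ht (by positivity)).mp hk2
    linarith

end Majorant

end LacunarySeries

/-! ### Assembly of the theorem -/

theorem theorem2 (p : ℝ) (hp : 1 < p) (φ : ℝ → ℝ)
    (hpos : ∀ r ∈ Set.Ico (0 : ℝ) 1, 0 < φ r)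
    (hmono : MonotoneOn φ (Set.Ico (0 : ℝ) 1))
    (hint : ∫⁻ r in Set.Ico (0 : ℝ) 1, ENNReal.ofReal ((1 - r) ^ (p - 2) * φ r ^ p) < ⊤) :
    ∃ f : ℂ → ℂ,
      f ∈ (DiscSpaces.Besov p ∩ DiscSpaces.HardyInfty) \ DiscSpaces.BesovOne ∧
      (∃ C : ℝ, 0 < C ∧ ∀ r ∈ Set.Ico (0 : ℝ) 1,
        C * φ r ≤ DiscSpaces.integralMean p r (deriv f)) ∧
      ∀ θ ∈ Set.Icc (0 : ℝ) (2 * Real.pi),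
        ∫⁻ r in Set.Ico (0 : ℝ) 1,
          ‖deriv (deriv f) ((r : ℂ) * Complex.exp ((θ : ℂ) * Complex.I))‖ₑ = ⊤ := by
  obtain ⟨L, hL⟩ : ∃ L : ℕ, 4096 ≤ L := ⟨4096, le_rfl⟩
  have hL2 : 2 ≤ L := by omega
  -- The shift to `k + 1` samples `φ` at the right end of the `k`-th interval, so that `b k`
  -- dominates `φ` on all of it.
  set b : ℕ → ℝ := fun k => φ (1 - 1 / (L : ℝ) ^ (k + 1)) with hbdef
  have hmem := LacunarySeries.one_sub_inv_pow_mem_Ico hL2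
  have hb : ∀ k, 0 < b k := fun k => hpos _ (hmem (k + 1))
  have hb' : ∀ k, 0 ≤ b k := fun k => (hb k).le
  have hbm : Monotone b := fun i j hij => hmono (hmem _) (hmem _)
    ((LacunarySeries.strictMono_one_sub_inv_pow hL2).monotone (Nat.succ_le_succ hij))
  have hsp : Summable fun k => b k ^ p * ((L : ℝ) ^ k) ^ (1 - p) :=
    LacunarySeries.summable_rpow_of_lintegral_lt_top hp hpos hmono hint hL2
  have hs := LacunarySeries.summable_div_pow_of_summable hp hL2 hb' hsp
  refine ⟨LacunarySeries.series L b,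
    ⟨⟨LacunarySeries.series_mem_besov hp (by omega) hb' hs hsp,
      LacunarySeries.series_mem_hardyInfty hb' hs⟩,
      LacunarySeries.series_notMem_besovOne hL hb hbm hs⟩,
    ⟨Real.exp (-1), Real.exp_pos _, fun r hr => ?_⟩, fun θ _ => ?_⟩
  · obtain ⟨k, hk1, hk2⟩ := LacunarySeries.exists_one_sub_inv_pow_le hL2 hr
    have hpow : Real.exp (-1) ≤ r ^ (L ^ k - 1) :=
      LacunarySeries.exp_neg_one_le_pow_sub_one (Nat.one_le_pow k L (by omega))
        (by push_cast; exact hk1)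
    have hφ : φ r ≤ b k := hmono hr (hmem (k + 1)) hk2
    calc Real.exp (-1) * φ r ≤ r ^ (L ^ k - 1) * b k :=
          mul_le_mul hpow hφ (hpos r hr).le ((Real.exp_pos _).le.trans hpow)
      _ = b k * r ^ (L ^ k - 1) := mul_comm _ _
      _ ≤ _ := LacunarySeries.coeff_le_integralMean hp.le hL2 hb' hs hr.1 hr.2 k
          (mul_pos (hb k) ((Real.exp_pos _).trans_le hpow))
  · refine top_le_iff.mp ?_
    rw [← LacunarySeries.lintegral_norm_deriv_deriv_series_eq_top hL hb hbm hs θ]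
    exact lintegral_mono_set (Set.Ico_subset_Ico_left (by norm_num))
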